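/- For every constant $C\ge 1$ there exist constants $c_0=c_0(C)\in(0,1)$ and $c_1=c_1(C)\in(0,1)$ such that the following holds. Let $\eta'\in\left(0,\tfrac{1}{32C}\right)$ and $\kappa\in(0,1)$. Let $X_1,\dots,X_\ell$ be independent (not necessarily identically distributed) zero-mean symmetric real random variables taking values in $[-C,-1]\cup[1,C]$, where symmetric means that $X_i$ and $-X_i$ have the same distribution. Let $Z=\sum_{i=1}^{\ell}a_iX_i$, where $a\in\mathbb{R}^{\ell}$ satisfies $\|a\|_2=1$ and $\|a\|_\infty\le\eta$. Then for all $t\ge 1$ and $\beta\in\left(\tfrac{1}{16C},\tfrac{7}{16C}\right)$ with $\eta<c_1t$, $$\Pr\Big[Z\in\big[(1-\eta')t,\ (1+\eta')Ct\big]\Big]\ge\kappa\ \Longrightarrow\ \Pr\Big[Z\in\big[\tfrac{\beta}{2}(1-\eta')t,\ \tfrac{3}{2}\beta(1+\eta')Ct\big]\Big]\ge\min\Big\{\frac{\kappa}{2},\,c_0\Big\}.$$ -/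

import Mathlib

open MeasureTheory ProbabilityTheory

/-! Symmetry and independence make the law of `Z` invariant under replacing each `X i` by `s i * X
i` for fixed signs `s`, and hence for random signs independent of `X`. The size of `t` relative to
`C ^ 2` decides which signs to use.

If `t` is large, take independent signs of mean `β`. Given `X`, the new sum has mean `β * Z` and
variance at most `C ^ 2`, so by Chebyshev a value of `Z` in the first window moves to the second
with probability at least `1 / 2`. This costs half of `κ`
(`measureReal_div_two_le_measureReal_shrink`).

If `t` is bounded, the second window has mass at least `c₀` whatever `κ` is. All coefficients are
tiny, so the indices split into `n ^ 2` blocks of nearly equal variance. By second and fourth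
moments each block sum has size of order `1 / n` with probability bounded below, and the blocks are
independent. On that event some choice of block signs steers the sum close to `β * t`. All `2 ^ n ^
2` choices have the same probability, so a union bound concludes (`le_measureReal_abs_sub_sum_le`).
-/

/-! ### Deterministic greedy arguments: steering by signs and balancing of weights. -/

section SignSteering

/-- Greedy choice of signs: a target within `hi + n * lo` of the origin is reached up to `hi` by a
signed sum of `n` numbers with absolute values in `[lo, hi]`. -/
theorem exists_sign_abs_sub_sum_le {κ : Type*} (J : Finset κ) {lo hi : ℝ} (hlo : 0 ≤ lo) (y : κ → ℝ)
    (hy : ∀ j ∈ J, lo ≤ |y j| ∧ |y j| ≤ hi) (x : ℝ) (hx : |x| ≤ hi + J.card * lo) :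
    ∃ s : κ → Bool, |x - ∑ j ∈ J, (if s j then 1 else -1) * y j| ≤ hi := by
  classical
  induction J using Finset.induction_on generalizing x with
  | empty => exact ⟨fun _ => true, by simpa using hx⟩
  | insert j J hj ih =>
    obtain ⟨b, hb⟩ : ∃ b : Bool, |x - (if b then 1 else -1) * y j| ≤ hi + J.card * lo := by
      have h1 := hy j (Finset.mem_insert_self _ _)
      have h2 : 0 ≤ J.card * lo := by positivity
      rw [Finset.card_insert_of_notMem hj] at hx
      push_cast at hx
      -- If `z` has the sign of `x`, then `|x - z|` is at most `max (|x| - lo) hi`.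
      obtain ⟨b, hb⟩ : ∃ b : Bool, 0 ≤ x * ((if b then 1 else -1) * y j) := by
        rcases le_total 0 (x * y j) with h | h
        · exact ⟨true, by simpa using h⟩
        · exact ⟨false, by simpa using h⟩
      have hz : |(if b then 1 else -1) * y j| = |y j| := by
        cases b <;> simp
      refine ⟨b, ?_⟩
      rw [← hz] at h1
      generalize (if b then 1 else -1) * y j = z at h1 hb
      have hx' := abs_le.1 hx
      rcases mul_nonneg_iff.1 hb with ⟨h, h'⟩ | ⟨h, h'⟩
      · rw [abs_of_nonneg h'] at h1
        exact abs_le.2 ⟨by linarith, by linarith⟩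
      · rw [abs_of_nonpos h'] at h1
        exact abs_le.2 ⟨by linarith, by linarith⟩
    obtain ⟨s, hs⟩ := ih (fun k hk => hy k (Finset.mem_insert_of_mem hk)) _ hb
    refine ⟨Function.update s j b, ?_⟩
    rw [Finset.sum_insert hj]
    have : ∑ k ∈ J, (if Function.update s j b k then (1 : ℝ) else -1) * y k
        = ∑ k ∈ J, (if s k then 1 else -1) * y k :=
      Finset.sum_congr rfl fun k hk => by
        rw [Function.update_of_ne (ne_of_mem_of_not_mem hk hj)]
    rw [this, Function.update_self, ← sub_sub]
    exact hs

/-- Greedy load balancing: weights in `[0, d]` can be coloured so that any two colour classes have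
total weights that differ by at most `d`. -/
theorem exists_coloring_sum_le_add {ι κ : Type*} [Fintype κ] [Nonempty κ] [DecidableEq κ]
    (I : Finset ι) (w : ι → ℝ) {d : ℝ} (hd : 0 ≤ d) (hw0 : ∀ i, 0 ≤ w i) (hw : ∀ i, w i ≤ d) :
    ∃ g : ι → κ, ∀ j k, ∑ i ∈ I with g i = j, w i ≤ ∑ i ∈ I with g i = k, w i + d := by
  classical
  induction I using Finset.induction_on with
  | empty => exact ⟨fun _ => Classical.arbitrary κ, by simpa using hd⟩
  | insert i I hi ih =>
    obtain ⟨g, hg⟩ := ih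
    -- The new weight goes to the lightest class.
    obtain ⟨m, hm⟩ := Finite.exists_min fun j => ∑ i ∈ I with g i = j, w i
    refine ⟨Function.update g i m, fun j k => ?_⟩
    have key : ∀ j, ∑ i' ∈ insert i I with Function.update g i m i' = j, w i'
        = (if m = j then w i else 0) + ∑ i' ∈ I with g i' = j, w i' := by
      intro j
      simp only [Finset.sum_filter]
      rw [Finset.sum_insert hi, Function.update_self]
      congr 1
      exact Finset.sum_congr rfl fun k hk => by
        rw [Function.update_of_ne (ne_of_mem_of_not_mem hk hi)]
    rw [key, key]
    have h1 := hg j k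
    have h2 := hm j
    have h3 := hm k
    have h4 := hw i
    have h5 := hw0 i
    split_ifs with hj hk hk
    · linarith
    · subst hj; linarith
    · linarith
    · linarith

end SignSteering

/-! ### Moments of two-term sums and a Paley–Zygmund type bound. -/

section Moments

variable {Ω : Type*} [MeasurableSpace Ω] {P : Measure Ω} [IsProbabilityMeasure P]

theorem integrable_pow_mul_pow_of_abs_le {Y W : Ω → ℝ} (hY : Measurable Y) (hW : Measurable W)
    {B D : ℝ} (hYB : ∀ᵐ ω ∂P, |Y ω| ≤ B) (hWD : ∀ᵐ ω ∂P, |W ω| ≤ D) (m n : ℕ) :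
    Integrable (fun ω => Y ω ^ m * W ω ^ n) P := by
  refine Integrable.of_bound (C := B ^ m * D ^ n) (by fun_prop) ?_
  filter_upwards [hYB, hWD] with ω h1 h2
  rw [Real.norm_eq_abs, abs_mul, abs_pow, abs_pow]
  have := (abs_nonneg _).trans h1
  gcongr

/-- Moments of a sum of two bounded independent variables with vanishing first moments. -/
theorem IndepFun.integral_add_pow {Y W : Ω → ℝ} (hY : Measurable Y) (hW : Measurable W)
    {B D : ℝ} (hYB : ∀ᵐ ω ∂P, |Y ω| ≤ B) (hWD : ∀ᵐ ω ∂P, |W ω| ≤ D) (hYW : IndepFun Y W P)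
    (hY1 : ∫ ω, Y ω ∂P = 0) (hW1 : ∫ ω, W ω ∂P = 0) (hW3 : ∫ ω, W ω ^ 3 ∂P = 0) :
    ∫ ω, (Y ω + W ω) ∂P = 0 ∧
    ∫ ω, (Y ω + W ω) ^ 2 ∂P = ∫ ω, Y ω ^ 2 ∂P + ∫ ω, W ω ^ 2 ∂P ∧
    ∫ ω, (Y ω + W ω) ^ 4 ∂P =
      ∫ ω, Y ω ^ 4 ∂P + 6 * (∫ ω, Y ω ^ 2 ∂P) * (∫ ω, W ω ^ 2 ∂P) + ∫ ω, W ω ^ 4 ∂P := by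
  have hI := integrable_pow_mul_pow_of_abs_le hY hW hYB hWD
  have hE : ∀ m n : ℕ, ∫ ω, Y ω ^ m * W ω ^ n ∂P = (∫ ω, Y ω ^ m ∂P) * ∫ ω, W ω ^ n ∂P :=
    fun m n => (hYW.comp (measurable_id.pow_const m) (measurable_id.pow_const n)
      ).integral_fun_mul_eq_mul_integral (by fun_prop) (by fun_prop)
  have hYi : ∀ m : ℕ, Integrable (fun ω => Y ω ^ m) P := fun m => by simpa using hI m 0
  have hWi : ∀ m : ℕ, Integrable (fun ω => W ω ^ m) P := fun m => by simpa using hI 0 m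
  refine ⟨?_, ?_, ?_⟩
  · rw [integral_add (by simpa using hYi 1) (by simpa using hWi 1), hY1, hW1, add_zero]
  · have : (fun ω => (Y ω + W ω) ^ 2)
        = fun ω => (Y ω ^ 2 + W ω ^ 2) + 2 * (Y ω ^ 1 * W ω ^ 1) := by
      funext ω; ring
    rw [this, integral_add ((hYi 2).fun_add (hWi 2)) ((hI 1 1).const_mul 2),
      integral_add (hYi 2) (hWi 2), integral_const_mul, hE]
    simp [hY1]
  · have : (fun ω => (Y ω + W ω) ^ 4)
        = fun ω => ((Y ω ^ 4 + W ω ^ 4) + 6 * (Y ω ^ 2 * W ω ^ 2))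
          + (4 * (Y ω ^ 3 * W ω ^ 1) + 4 * (Y ω ^ 1 * W ω ^ 3)) := by
      funext ω; ring
    rw [this, integral_add (((hYi 4).fun_add (hWi 4)).fun_add ((hI 2 2).const_mul 6))
      (((hI 3 1).const_mul 4).fun_add ((hI 1 3).const_mul 4)),
      integral_add ((hYi 4).fun_add (hWi 4)) ((hI 2 2).const_mul 6),
      integral_add ((hI 3 1).const_mul 4) ((hI 1 3).const_mul 4),
      integral_add (hYi 4) (hWi 4), integral_const_mul, integral_const_mul, integral_const_mul,
      hE, hE, hE, hW3]
    simp [hW1]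
    ring

/-- A second-moment lower bound and a fourth-moment upper bound put mass on an annulus. -/
theorem le_measureReal_abs_mem_Icc {Y : Ω → ℝ} (hY : Measurable Y) {B lo hi : ℝ}
    (hYB : ∀ᵐ ω ∂P, |Y ω| ≤ B) (hhi : 0 < hi) :
    ∫ ω, Y ω ^ 2 ∂P ≤ lo ^ 2 + hi ^ 2 * P.real {ω | |Y ω| ∈ Set.Icc lo hi}
      + (∫ ω, Y ω ^ 4 ∂P) / hi ^ 2 := by
  have hI : ∀ m : ℕ, Integrable (fun ω => Y ω ^ m) P := fun m => by
    simpa using integrable_pow_mul_pow_of_abs_le hY hY hYB hYB m 0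
  set A : Set Ω := {ω | |Y ω| ∈ Set.Icc lo hi}
  have hA : MeasurableSet A := (by fun_prop : Measurable fun ω => |Y ω|) measurableSet_Icc
  have hind : Integrable (A.indicator fun _ => hi ^ 2) P := (integrable_const _).indicator hA
  -- The three terms dominate `Y ^ 2` below, inside and above the annulus respectively.
  have hpt : ∀ ω, Y ω ^ 2 ≤ lo ^ 2 + A.indicator (fun _ => hi ^ 2) ω + Y ω ^ 4 / hi ^ 2 := by
    intro ω
    have h4 : 0 ≤ Y ω ^ 4 / hi ^ 2 := by positivity
    have hi2 : 0 ≤ A.indicator (fun _ => hi ^ 2) ω :=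
      Set.indicator_nonneg (fun _ _ => sq_nonneg _) _
    rcases lt_or_ge (|Y ω|) lo with h | h
    · have : Y ω ^ 2 ≤ lo ^ 2 := by
        rw [← sq_abs]; gcongr
      linarith
    rcases le_or_gt (|Y ω|) hi with h' | h'
    · rw [Set.indicator_of_mem (show ω ∈ A from ⟨h, h'⟩)]
      have : Y ω ^ 2 ≤ hi ^ 2 := by
        rw [← sq_abs]; gcongr
      nlinarith [sq_nonneg lo]
    · have : Y ω ^ 2 ≤ Y ω ^ 4 / hi ^ 2 := by
        rw [le_div_iff₀ (by positivity)]
        have : hi ^ 2 ≤ Y ω ^ 2 := by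
          rw [← sq_abs (Y ω)]; gcongr
        nlinarith [sq_nonneg (Y ω)]
      nlinarith [sq_nonneg lo]
  calc ∫ ω, Y ω ^ 2 ∂P
      ≤ ∫ ω, (lo ^ 2 + A.indicator (fun _ => hi ^ 2) ω + Y ω ^ 4 / hi ^ 2) ∂P :=
        integral_mono (hI 2) (((integrable_const _).fun_add hind).fun_add ((hI 4).div_const _)) hpt
    _ = _ := by
        rw [integral_add ((integrable_const _).fun_add hind) ((hI 4).div_const _),
          integral_add (integrable_const _) hind, integral_div, integral_indicator_const _ hA]
        simp [mul_comm]

end Moments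

/-! ### Weighted sums under a product of symmetric laws. -/

section ProductMeasure

variable {ι : Type*} [Fintype ι] {ν : ι → Measure ℝ} [∀ i, IsProbabilityMeasure (ν i)]

theorem measurePreserving_sign_mul_pi (hsym : ∀ i, (ν i).map (fun x => -x) = ν i) {s : ι → ℝ}
    (hs : ∀ i, s i = 1 ∨ s i = -1) :
    MeasurePreserving (fun (x : ι → ℝ) i => s i * x i) (Measure.pi ν) (Measure.pi ν) := by
  refine measurePreserving_pi ν ν (f := fun i y => s i * y) fun i => ?_
  rcases hs i with h | h
  · simp_rw [h, one_mul]
    exact MeasurePreserving.id (ν i)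
  · simp_rw [h, neg_one_mul]
    exact ⟨measurable_neg, hsym i⟩

theorem measure_sign_mul_pi (hsym : ∀ i, (ν i).map (fun x => -x) = ν i) {s : ι → ℝ}
    (hs : ∀ i, s i = 1 ∨ s i = -1) (a : ι → ℝ) {A : Set ℝ} (hA : MeasurableSet A) :
    (Measure.pi ν) {x | ∑ i, a i * (s i * x i) ∈ A} = (Measure.pi ν) {x | ∑ i, a i * x i ∈ A} :=
  (measurePreserving_sign_mul_pi hsym hs).measure_preimage (s := {x | ∑ i, a i * x i ∈ A})
    ((by fun_prop : Measurable fun x : ι → ℝ => ∑ i, a i * x i) hA).nullMeasurableSet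

theorem ae_pi_abs_mem {C : ℝ} (habs : ∀ i, ∀ᵐ x ∂ν i, 1 ≤ |x| ∧ |x| ≤ C) :
    ∀ᵐ x ∂Measure.pi ν, ∀ i, 1 ≤ |x i| ∧ |x i| ≤ C :=
  ae_all_iff.2 fun i => (Measure.quasiMeasurePreserving_eval ν i).ae (habs i)

theorem ae_pi_abs_sum_le {C : ℝ} (habs : ∀ i, ∀ᵐ x ∂ν i, 1 ≤ |x| ∧ |x| ≤ C) (a : ι → ℝ)
    (S : Finset ι) : ∀ᵐ x ∂Measure.pi ν, |∑ i ∈ S, a i * x i| ≤ ∑ i ∈ S, |a i| * C := by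
  filter_upwards [ae_pi_abs_mem habs] with x hx
  refine (Finset.abs_sum_le_sum_abs _ _).trans (Finset.sum_le_sum fun i _ => ?_)
  rw [abs_mul]
  exact mul_le_mul_of_nonneg_left (hx i).2 (abs_nonneg _)

theorem integral_odd_pow_eq_zero {ρ : Measure ℝ} (hsym : ρ.map (fun x => -x) = ρ) {n : ℕ}
    (hn : Odd n) : ∫ x, x ^ n ∂ρ = 0 := by
  have h : ∫ x, x ^ n ∂ρ = ∫ x, (-x) ^ n ∂ρ := by
    conv_lhs => rw [← hsym]
    rw [integral_map (by fun_prop) (by fun_prop)]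
  simp_rw [hn.neg_pow, integral_neg] at h
  linarith

/-- Second and fourth moments of a weighted sum of independent symmetric variables whose absolute
values lie in `[1, C]`. -/
theorem moments_sum_pi [DecidableEq ι] {C : ℝ} (hsym : ∀ i, (ν i).map (fun x => -x) = ν i)
    (habs : ∀ i, ∀ᵐ x ∂ν i, 1 ≤ |x| ∧ |x| ≤ C) (a : ι → ℝ) (S : Finset ι) :
    ∫ x, (∑ i ∈ S, a i * x i) ∂Measure.pi ν = 0 ∧
    ∑ i ∈ S, a i ^ 2 ≤ ∫ x, (∑ i ∈ S, a i * x i) ^ 2 ∂Measure.pi ν ∧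
    ∫ x, (∑ i ∈ S, a i * x i) ^ 2 ∂Measure.pi ν ≤ C ^ 2 * ∑ i ∈ S, a i ^ 2 ∧
    ∫ x, (∑ i ∈ S, a i * x i) ^ 4 ∂Measure.pi ν ≤ 3 * C ^ 4 * (∑ i ∈ S, a i ^ 2) ^ 2 := by
  induction S using Finset.induction_on with
  | empty => simp
  | insert j S hj ih =>
    obtain ⟨ih1, ih2, ih2', ih4⟩ := ih
    have hW : ∀ n, ∫ x, (a j * x j) ^ n ∂Measure.pi ν = a j ^ n * ∫ y, y ^ n ∂ν j := fun n => by
      rw [← integral_const_mul, ← integral_comp_eval (μ := ν) (i := j)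
        (f := fun y => a j ^ n * y ^ n) (by fun_prop)]
      simp_rw [mul_pow]
    have hW1 : ∫ x, a j * x j ∂Measure.pi ν = 0 := by
      have h := hW 1
      rw [integral_odd_pow_eq_zero (hsym j) odd_one, mul_zero] at h
      simpa only [pow_one] using h
    have hind : IndepFun (fun x : ι → ℝ => ∑ i ∈ S, a i * x i) (fun x => a j * x j)
        (Measure.pi ν) := by
      have h := (iIndepFun_pi (μ := ν) (X := fun i y => a i * y)
        (fun i => by fun_prop)).indepFun_finsetSum_of_notMem (fun i => by fun_prop) hj
      convert h using 1
      ext x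
      simp
    have hWD : ∀ᵐ x ∂Measure.pi ν, |a j * x j| ≤ |a j| * C := by
      simpa using ae_pi_abs_sum_le habs a {j}
    obtain ⟨h1, h2, h4⟩ := IndepFun.integral_add_pow (by fun_prop) (by fun_prop)
      (ae_pi_abs_sum_le habs a S) hWD hind ih1
      hW1
      (by rw [hW 3, integral_odd_pow_eq_zero (hsym j) (by decide), mul_zero])
    have hid : ∀ n, Integrable (fun y : ℝ => y ^ n) (ν j) := fun n => by
      refine Integrable.of_bound (C := C ^ n) (by fun_prop) ?_
      filter_upwards [habs j] with y hy
      rw [Real.norm_eq_abs, abs_pow]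
      exact pow_le_pow_left₀ (abs_nonneg _) hy.2 n
    have hl2 : 1 ≤ ∫ y, y ^ 2 ∂ν j := by
      simpa using integral_mono_ae (μ := ν j) (integrable_const (1 : ℝ)) (hid 2) (by
        filter_upwards [habs j] with y hy
        simpa using hy.1)
    have hu2 : ∫ y, y ^ 2 ∂ν j ≤ C ^ 2 := by
      simpa using integral_mono_ae (μ := ν j) (hid 2) (integrable_const (C ^ 2)) (by
        filter_upwards [habs j] with y hy
        simpa using pow_le_pow_left₀ (abs_nonneg _) hy.2 2)
    have hu4 : ∫ y, y ^ 4 ∂ν j ≤ C ^ 4 := by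
      simpa using integral_mono_ae (μ := ν j) (hid 4) (integrable_const (C ^ 4)) (by
        filter_upwards [habs j] with y hy
        have := pow_le_pow_left₀ (abs_nonneg _) hy.2 4
        rwa [← abs_pow, abs_of_nonneg (by positivity)] at this)
    simp_rw [Finset.sum_insert hj, add_comm (a j * _), add_comm (a j ^ 2)]
    rw [h1, h2, h4, hW, hW]
    have hs : 0 ≤ ∑ i ∈ S, a i ^ 2 := Finset.sum_nonneg fun i _ => sq_nonneg _
    have ha := sq_nonneg (a j)
    have ha4 : 0 ≤ a j ^ 4 := by positivity
    refine ⟨rfl, by nlinarith, by nlinarith, ?_⟩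
    have hC4 : 0 ≤ C ^ 4 := by positivity
    -- The cross term, with its factor `6`, matches that of `3 * C ^ 4 * (V + a j ^ 2) ^ 2`, where
    -- `V` is the sum over `S`.
    have e1 : (∫ x, (∑ i ∈ S, a i * x i) ^ 2 ∂Measure.pi ν) * (a j ^ 2 * ∫ y, y ^ 2 ∂ν j)
        ≤ (C ^ 2 * ∑ i ∈ S, a i ^ 2) * (a j ^ 2 * C ^ 2) := by gcongr
    have e2 : a j ^ 4 * ∫ y, y ^ 4 ∂ν j ≤ a j ^ 4 * C ^ 4 := by gcongr
    have e3 := mul_nonneg ha4 hC4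
    nlinarith

/-- With variance weight `V` of order `1 / n ^ 2`, the outer radius makes the fourth-moment term at
most `9 / 50 * V` and the inner radius costs only `1 / (9 * n ^ 2)`. The rest of `V` must come from
the annulus. -/
theorem measureReal_annulus_sum_pi [DecidableEq ι] {C : ℝ} (hC : 1 ≤ C)
    (hsym : ∀ i, (ν i).map (fun x => -x) = ν i)
    (habs : ∀ i, ∀ᵐ x ∂ν i, 1 ≤ |x| ∧ |x| ≤ C) (a : ι → ℝ) (S : Finset ι) {n : ℕ} (hn : 0 < n)
    (hl : 1 / (2 * (n : ℝ) ^ 2) ≤ ∑ i ∈ S, a i ^ 2)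
    (hu : ∑ i ∈ S, a i ^ 2 ≤ 3 / (2 * (n : ℝ) ^ 2)) :
    1 / (100 * C ^ 4) ≤ (Measure.pi ν).real
      {x | |∑ i ∈ S, a i * x i| ∈ Set.Icc (1 / (3 * (n : ℝ))) (5 * C ^ 2 / n)} := by
  have hn' : (0 : ℝ) < n := by exact_mod_cast hn
  have hC0 : 0 < C := by linarith
  obtain ⟨-, h2, -, h4⟩ := moments_sum_pi hsym habs a S
  have key := le_measureReal_abs_mem_Icc (P := Measure.pi ν) (lo := 1 / (3 * (n : ℝ)))
    (hi := 5 * C ^ 2 / n) (by fun_prop) (ae_pi_abs_sum_le habs a S) (by positivity)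
  set p := (Measure.pi ν).real
      {x | |∑ i ∈ S, a i * x i| ∈ Set.Icc (1 / (3 * (n : ℝ))) (5 * C ^ 2 / n)}
  set V := ∑ i ∈ S, a i ^ 2
  have h5 : (∫ x, (∑ i ∈ S, a i * x i) ^ 4 ∂Measure.pi ν) / (5 * C ^ 2 / n) ^ 2
      ≤ 3 / 25 * V * (V * (n : ℝ) ^ 2) := by
    rw [div_le_iff₀ (by positivity)]
    refine h4.trans (le_of_eq ?_)
    field_simp
    norm_num
  have hVl : 1 / 2 ≤ V * (n : ℝ) ^ 2 := by
    rw [div_le_iff₀ (by positivity)] at hl; linarith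
  have hVu : V * (n : ℝ) ^ 2 ≤ 3 / 2 := by
    rw [le_div_iff₀ (by positivity)] at hu; linarith
  have hV : 0 ≤ V := Finset.sum_nonneg fun i _ => sq_nonneg _
  have h6 : V ≤ (1 / (3 * (n : ℝ))) ^ 2 + (5 * C ^ 2 / n) ^ 2 * p + 9 / 50 * V := by
    nlinarith
  have h7 : V * (n : ℝ) ^ 2 ≤ 1 / 9 + 25 * C ^ 4 * p + 9 / 50 * (V * (n : ℝ) ^ 2) := by
    have := mul_le_mul_of_nonneg_right h6 (sq_nonneg (n : ℝ))
    refine this.trans (le_of_eq ?_)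
    field_simp
    ring
  rw [div_le_iff₀ (by positivity)]
  nlinarith

end ProductMeasure

/-! ### Bounded targets: independent blocks and steering by block signs. -/

section Blocks

variable {ι : Type*} [Fintype ι] {ν : ι → Measure ℝ} [∀ i, IsProbabilityMeasure (ν i)]

/-- Weighted sums over distinct colour classes are independent. -/
theorem measureReal_forall_block_mem {κ : Type*} [DecidableEq κ] (g : ι → κ) (a : ι → ℝ)
    {K : Set ℝ} (hK : MeasurableSet K) (J : Finset κ) :
    (Measure.pi ν).real {x | ∀ j ∈ J, ∑ i with g i = j, a i * x i ∈ K}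
      = ∏ j ∈ J, (Measure.pi ν).real {x | ∑ i with g i = j, a i * x i ∈ K} := by
  classical
  induction J using Finset.induction_on with
  | empty => simp
  | insert j J hj ih =>
    rw [Finset.prod_insert hj, ← ih]
    have hdis : Disjoint ({i | g i = j} : Finset ι) ({i | g i ∈ J} : Finset ι) := by
      rw [Finset.disjoint_filter]
      rintro i - rfl
      exact hj
    have hind := (iIndepFun_pi (μ := ν) (X := fun i y => a i * y)
      (fun i => by fun_prop)).indepFun_finset _ _ hdis (fun i => by fun_prop)
    have hφ : Measurable fun z : ({i | g i = j} : Finset ι) → ℝ => ∑ i, z i := by fun_prop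
    -- All block sums over `J` form one vector-valued function of the coordinates coloured in `J`,
    -- so independence of two disjoint coordinate sets suffices.
    have hψ : Measurable fun (z : ({i | g i ∈ J} : Finset ι) → ℝ) (k : J) =>
        ∑ i : ({i | g i ∈ J} : Finset ι), if g i = k then z i else 0 :=
      measurable_pi_lambda _ fun k => Finset.measurable_sum _ fun i _ => by
        split_ifs <;> fun_prop
    have h := (hind.comp hφ hψ).measure_inter_preimage_eq_mul K (Set.univ.pi fun _ => K) hK
      (MeasurableSet.univ_pi fun _ => hK)
    have e1 : ((fun z : ({i | g i = j} : Finset ι) → ℝ => ∑ i, z i) ∘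
        fun (x : ι → ℝ) (i : ({i | g i = j} : Finset ι)) => a i * x i) ⁻¹' K
        = {x | ∑ i with g i = j, a i * x i ∈ K} := by
      ext x
      simp only [Set.mem_preimage, Function.comp, Set.mem_ofPred_eq]
      rw [Finset.sum_coe_sort ({i | g i = j} : Finset ι) fun i => a i * x i]
    have e2 : ((fun (z : ({i | g i ∈ J} : Finset ι) → ℝ) (k : J) =>
        ∑ i : ({i | g i ∈ J} : Finset ι), if g i = k then z i else 0) ∘
        fun (x : ι → ℝ) (i : ({i | g i ∈ J} : Finset ι)) => a i * x i) ⁻¹'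
          (Set.univ.pi fun _ => K)
        = {x | ∀ j ∈ J, ∑ i with g i = j, a i * x i ∈ K} := by
      ext x
      simp only [Set.mem_preimage, Function.comp, Set.mem_ofPred_eq, Set.mem_univ_pi,
        Subtype.forall]
      refine forall₂_congr fun k hk => ?_
      rw [Finset.sum_coe_sort ({i | g i ∈ J} : Finset ι) fun i => if g i = k then a i * x i else 0,
        ← Finset.sum_filter, Finset.filter_filter]
      have : ∀ i, (g i ∈ J ∧ g i = k) ↔ g i = k := fun i =>
        ⟨And.right, fun h => ⟨h ▸ hk, h⟩⟩
      simp only [this]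
    rw [e1, e2] at h
    rw [measureReal_def, measureReal_def, measureReal_def, ← ENNReal.toReal_mul, ← h]
    congr 2
    ext x
    simp

/-- A weighted sum of many small independent symmetric variables charges every interval of length
comparable to `1 / n` centred within distance `n / 3` of the origin. -/
theorem le_measureReal_abs_sub_sum_le [DecidableEq ι] {C : ℝ} (hC : 1 ≤ C)
    (hsym : ∀ i, (ν i).map (fun x => -x) = ν i)
    (habs : ∀ i, ∀ᵐ x ∂ν i, 1 ≤ |x| ∧ |x| ≤ C) {a : ι → ℝ} (ha : ∑ i, a i ^ 2 = 1)
    {n : ℕ} (hn : 0 < n) (hsmall : ∀ i, a i ^ 2 ≤ 1 / (2 * (n : ℝ) ^ 2)) {m : ℝ}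
    (hm : |m| ≤ n / 3) :
    (1 / (200 * C ^ 4)) ^ n ^ 2 ≤
      (Measure.pi ν).real {x | |m - ∑ i, a i * x i| ≤ 5 * C ^ 2 / n} := by
  have hn' : (0 : ℝ) < n := by exact_mod_cast hn
  have hC0 : 0 < C := by linarith
  have : Nonempty (Fin (n ^ 2)) := ⟨⟨0, by positivity⟩⟩
  set d : ℝ := 1 / (2 * (n : ℝ) ^ 2) with hd
  have hd0 : 0 ≤ d := by positivity
  have hdn : (n : ℝ) ^ 2 * d = 1 / 2 := by rw [hd]; field_simp
  obtain ⟨g, hg⟩ := exists_coloring_sum_le_add (κ := Fin (n ^ 2)) Finset.univ (fun i => a i ^ 2)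
    hd0 (fun i => sq_nonneg _) hsmall
  have htot : ∑ j, ∑ i with g i = j, a i ^ 2 = 1 := by
    rw [Finset.sum_fiberwise, ha]
  -- The average block weight is `1 / n ^ 2`, and balancing keeps each block within `d`, half of
  -- that, of the average.
  have hu : ∀ j, ∑ i with g i = j, a i ^ 2 ≤ 3 / (2 * (n : ℝ) ^ 2) := fun j => by
    have h := Finset.sum_le_sum fun k (_ : k ∈ Finset.univ) => hg j k
    rw [Finset.sum_add_distrib, htot] at h
    simp only [Finset.sum_const, Finset.card_univ, Fintype.card_fin, nsmul_eq_mul] at h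
    push_cast at h
    rw [le_div_iff₀ (by positivity)]
    linarith
  have hl : ∀ j, 1 / (2 * (n : ℝ) ^ 2) ≤ ∑ i with g i = j, a i ^ 2 := fun j => by
    have h := Finset.sum_le_sum fun k (_ : k ∈ Finset.univ) => hg k j
    rw [htot] at h
    simp only [Finset.sum_const, Finset.card_univ, Fintype.card_fin, nsmul_eq_mul] at h
    push_cast at h
    rw [div_le_iff₀ (by positivity)]
    linarith
  set K : Set ℝ := {y | |y| ∈ Set.Icc (1 / (3 * (n : ℝ))) (5 * C ^ 2 / n)}
  have hK : MeasurableSet K := (by fun_prop : Measurable fun y : ℝ => |y|) measurableSet_Icc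
  have hblock : (1 / (100 * C ^ 4)) ^ n ^ 2 ≤
      (Measure.pi ν).real {x | ∀ j ∈ Finset.univ, ∑ i with g i = j, a i * x i ∈ K} := by
    rw [measureReal_forall_block_mem g a hK]
    refine le_trans (le_of_eq ?_) (Finset.prod_le_prod (fun j _ => by positivity) fun j _ =>
      measureReal_annulus_sum_pi hC hsym habs a _ hn (hl j) (hu j))
    simp
  set q := (Measure.pi ν).real {x | |m - ∑ i, a i * x i| ≤ 5 * C ^ 2 / n}
  have hflip : ∀ s : Fin (n ^ 2) → Bool, (Measure.pi ν).real
      {x | |m - ∑ i, a i * ((if s (g i) then 1 else -1) * x i)| ≤ 5 * C ^ 2 / n} = q := fun s => by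
    have hA : MeasurableSet {y : ℝ | |m - y| ≤ 5 * C ^ 2 / n} :=
      (by fun_prop : Measurable fun y : ℝ => |m - y|) measurableSet_Iic
    exact congrArg ENNReal.toReal (measure_sign_mul_pi hsym
      (s := fun i => if s (g i) then 1 else -1) (fun i => by cases s (g i) <;> simp) a hA)
  have hcover : {x : ι → ℝ | ∀ j ∈ Finset.univ, ∑ i with g i = j, a i * x i ∈ K} ⊆
      ⋃ s ∈ (Finset.univ : Finset (Fin (n ^ 2) → Bool)),
        {x | |m - ∑ i, a i * ((if s (g i) then 1 else -1) * x i)| ≤ 5 * C ^ 2 / n} := by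
    intro x hx
    obtain ⟨s, hs⟩ := exists_sign_abs_sub_sum_le Finset.univ
      (by positivity : 0 ≤ 1 / (3 * (n : ℝ))) (fun j => ∑ i with g i = j, a i * x i)
      (fun j hj => hx j hj) m (by
        refine hm.trans ?_
        rw [Finset.card_univ, Fintype.card_fin]
        push_cast
        have : (n : ℝ) ^ 2 * (1 / (3 * n)) = n / 3 := by field_simp
        rw [this]
        have : 0 ≤ 5 * C ^ 2 / n := by positivity
        linarith)
    simp only [Set.mem_iUnion, Finset.mem_univ, exists_true_left, Set.mem_ofPred_eq]
    refine ⟨s, ?_⟩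
    convert hs using 3
    rw [← Finset.sum_fiberwise _ g]
    refine Finset.sum_congr rfl fun j _ => ?_
    rw [Finset.mul_sum]
    refine Finset.sum_congr rfl fun i hi => ?_
    rw [(Finset.mem_filter.1 hi).2]
    ring
  -- The union bound costs `2 ^ n ^ 2`, which turns `100` into `200` in the base.
  have hle := hblock.trans ((measureReal_mono hcover (measure_ne_top _ _)).trans (measureReal_biUnion_finset_le _ _))
  simp_rw [hflip] at hle
  simp only [Finset.sum_const, Finset.card_univ, Fintype.card_pi, Fintype.card_bool,
    Finset.prod_const, Fintype.card_fin, nsmul_eq_mul] at hle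
  push_cast at hle
  have : (1 / (200 * C ^ 4)) ^ n ^ 2 = (1 / (100 * C ^ 4)) ^ n ^ 2 / 2 ^ n ^ 2 := by
    rw [← div_pow]
    congr 1
    field_simp
    norm_num
  rw [this, div_le_iff₀ (by positivity)]
  linarith

end Blocks

/-! ### Distant targets: shrinking by biased random signs. -/

section Shrinking

/-- The law of a random sign with mean `β`. -/
noncomputable def biasedSign (β : ℝ) : Measure ℝ :=
  ENNReal.ofReal ((1 + β) / 2) • Measure.dirac 1 + ENNReal.ofReal ((1 - β) / 2) • Measure.dirac (-1)

theorem isProbabilityMeasure_biasedSign {β : ℝ} (h0 : -1 ≤ β) (h1 : β ≤ 1) :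
    IsProbabilityMeasure (biasedSign β) := by
  constructor
  simp only [biasedSign, Measure.coe_add, Measure.coe_smul, Pi.add_apply, Pi.smul_apply,
    measure_univ, smul_eq_mul, mul_one]
  rw [← ENNReal.ofReal_add (by linarith) (by linarith)]
  ring_nf
  simp

theorem ae_biasedSign (β : ℝ) : ∀ᵐ s ∂biasedSign β, s = 1 ∨ s = -1 := by
  have hm : MeasurableSet {s : ℝ | s = 1 ∨ s = -1} :=
    (measurableSet_singleton (1 : ℝ)).union (measurableSet_singleton (-1))
  rw [biasedSign, ae_add_measure_iff]
  constructor <;> refine Measure.ae_smul_measure ?_ _ <;> rw [ae_dirac_iff hm] <;> simp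

theorem integral_biasedSign {β : ℝ} (h0 : -1 ≤ β) (h1 : β ≤ 1) (f : ℝ → ℝ) :
    ∫ s, f s ∂biasedSign β = (1 + β) / 2 * f 1 + (1 - β) / 2 * f (-1) := by
  have hi : ∀ c : ℝ, Integrable f (Measure.dirac c) := fun c => integrable_dirac (by simp)
  rw [biasedSign, integral_add_measure ((hi _).smul_measure ENNReal.ofReal_ne_top)
    ((hi _).smul_measure ENNReal.ofReal_ne_top), integral_smul_measure, integral_smul_measure,
    integral_dirac, integral_dirac, ENNReal.toReal_ofReal (by linarith),
    ENNReal.toReal_ofReal (by linarith), smul_eq_mul, smul_eq_mul]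

variable {ι : Type*} [Fintype ι]

/-- Biased random signs shrink a sum by a factor close to their mean, with probability at least
one half, as soon as the sum is large compared to its Euclidean size. -/
theorem half_le_measure_pi_biasedSign {β : ℝ} (h0 : 0 < β) (h1 : β ≤ 1) (b : ι → ℝ) {p q : ℝ}
    (hp : 0 < p) (hb : ∑ i, b i ∈ Set.Icc p q) (hvar : 8 * ∑ i, b i ^ 2 ≤ β ^ 2 * p ^ 2) :
    1 / 2 ≤ Measure.pi (fun _ : ι => biasedSign β)
      {s | ∑ i, b i * s i ∈ Set.Icc (β / 2 * p) (3 / 2 * β * q)} := by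
  have := isProbabilityMeasure_biasedSign (by linarith : -1 ≤ β) h1
  have hmem : ∀ i, MemLp (fun s => b i * s) 2 (biasedSign β) := fun i => by
    refine MemLp.of_bound (by fun_prop) |b i| ?_
    filter_upwards [ae_biasedSign β] with s hs
    rcases hs with rfl | rfl <;> simp
  have hfun : (fun s : ι → ℝ => ∑ i, b i * s i) = ∑ i, fun s : ι → ℝ => b i * s i := by
    ext s; simp
  have hmemi : ∀ i, MemLp (fun s : ι → ℝ => b i * s i) 2
      (Measure.pi fun _ : ι => biasedSign β) := fun i =>
    (hmem i).comp_measurePreserving (measurePreserving_eval (fun _ : ι => biasedSign β) i)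
  have hmemf : MemLp (fun s : ι → ℝ => ∑ i, b i * s i) 2
      (Measure.pi fun _ : ι => biasedSign β) :=
    memLp_finsetSum _ fun i _ => hmemi i
  have hmean : ∫ s, ∑ i, b i * s i ∂(Measure.pi fun _ : ι => biasedSign β) = β * ∑ i, b i := by
    rw [integral_finsetSum _ fun i _ => (hmemi i).integrable (by norm_num), Finset.mul_sum]
    refine Finset.sum_congr rfl fun i _ => ?_
    rw [integral_comp_eval (μ := fun _ : ι => biasedSign β) (i := i) (f := fun y => b i * y)
      (by fun_prop), integral_biasedSign (by linarith) h1]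
    ring
  have hV : variance (fun s : ι → ℝ => ∑ i, b i * s i) (Measure.pi fun _ : ι => biasedSign β)
      ≤ ∑ i, b i ^ 2 := by
    rw [hfun, variance_sum_pi (X := fun i s => b i * s) hmem]
    refine Finset.sum_le_sum fun i _ => (variance_le_expectation_sq (by fun_prop)).trans
      (le_of_eq ?_)
    simp only [Pi.pow_apply]
    rw [integral_biasedSign (by linarith) h1]
    ring
  set z := ∑ i, b i
  have hz : 0 < z := hp.trans_le hb.1
  -- A deviation of half the mean fails with probability at most `4 * ∑ b i ^ 2 / (β * z) ^ 2`; the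
  -- `8` in `hvar` makes this at most `1 / 2`.
  have hcheb := meas_ge_le_variance_div_sq hmemf (c := β * z / 2) (by positivity)
  rw [hmean] at hcheb
  have hle : variance (fun s : ι → ℝ => ∑ i, b i * s i) (Measure.pi fun _ : ι => biasedSign β)
      / (β * z / 2) ^ 2 ≤ 1 / 2 := by
    rw [div_le_iff₀ (by positivity)]
    have : p ^ 2 ≤ z ^ 2 := pow_le_pow_left₀ hp.le hb.1 2
    nlinarith [mul_le_mul_of_nonneg_left this (sq_nonneg β)]
  have hA : MeasurableSet {s : ι → ℝ | β * z / 2 ≤ |∑ i, b i * s i - β * z|} :=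
    (by fun_prop : Measurable fun s : ι → ℝ => |∑ i, b i * s i - β * z|) measurableSet_Ici
  have hsub : {s : ι → ℝ | β * z / 2 ≤ |∑ i, b i * s i - β * z|}ᶜ ⊆
      {s | ∑ i, b i * s i ∈ Set.Icc (β / 2 * p) (3 / 2 * β * q)} := by
    intro s hs
    simp only [Set.mem_compl_iff, Set.mem_ofPred_eq, not_le] at hs
    have hs' := abs_lt.1 hs
    have e1 := mul_le_mul_of_nonneg_left hb.1 h0.le
    have e2 := mul_le_mul_of_nonneg_left hb.2 h0.le
    constructor <;> linarith
  refine le_trans ?_ (measure_mono hsub)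
  rw [prob_compl_eq_one_sub hA]
  have h2 : ENNReal.ofReal (1 / 2) = 1 / 2 := by
    rw [ENNReal.ofReal_div_of_pos (by norm_num)]; simp
  have h3 := hcheb.trans (ENNReal.ofReal_le_ofReal hle)
  rw [h2] at h3
  calc (1 / 2 : ENNReal) = 1 - 1 / 2 := by simp
    _ ≤ _ := tsub_le_tsub_left h3 1

/-- Shrinking an interval by a factor `β` costs at most half of its mass, if the interval lies far
enough from the origin. -/
theorem measureReal_div_two_le_measureReal_shrink {ν : ι → Measure ℝ}
    [∀ i, IsProbabilityMeasure (ν i)] {C : ℝ}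
    (hsym : ∀ i, (ν i).map (fun x => -x) = ν i)
    (habs : ∀ i, ∀ᵐ x ∂ν i, 1 ≤ |x| ∧ |x| ≤ C) {a : ι → ℝ} (ha : ∑ i, a i ^ 2 = 1)
    {β p q : ℝ} (h0 : 0 < β) (h1 : β ≤ 1) (hp : 0 < p) (hvar : 8 * C ^ 2 ≤ β ^ 2 * p ^ 2) :
    (Measure.pi ν).real {x | ∑ i, a i * x i ∈ Set.Icc p q} / 2 ≤
      (Measure.pi ν).real {x | ∑ i, a i * x i ∈ Set.Icc (β / 2 * p) (3 / 2 * β * q)} := by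
  have := isProbabilityMeasure_biasedSign (by linarith : -1 ≤ β) h1
  set ρ := Measure.pi fun _ : ι => biasedSign β
  set E : Set (ι → ℝ) := {x | ∑ i, a i * x i ∈ Set.Icc p q}
  set F : Set (ι → ℝ) := {x | ∑ i, a i * x i ∈ Set.Icc (β / 2 * p) (3 / 2 * β * q)}
  have hE : MeasurableSet E :=
    (by fun_prop : Measurable fun x : ι → ℝ => ∑ i, a i * x i) measurableSet_Icc
  set B : Set ((ι → ℝ) × (ι → ℝ)) :=
    {w | ∑ i, a i * (w.2 i * w.1 i) ∈ Set.Icc (β / 2 * p) (3 / 2 * β * q)}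
  have hB : MeasurableSet B :=
    (by fun_prop : Measurable fun w : (ι → ℝ) × (ι → ℝ) => ∑ i, a i * (w.2 i * w.1 i))
      measurableSet_Icc
  -- Fubini in both orders: fixing `x` gives the Chebyshev lower bound, fixing `s` gives exactly the
  -- mass of `F` by sign invariance.
  have hlower : 1 / 2 * Measure.pi ν E ≤ ((Measure.pi ν).prod ρ) B := by
    rw [Measure.prod_apply hB, ← lintegral_indicator_const hE]
    refine lintegral_mono_ae ?_
    filter_upwards [ae_pi_abs_mem habs] with x hx
    by_cases hxE : x ∈ E
    · rw [Set.indicator_of_mem hxE]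
      refine (half_le_measure_pi_biasedSign h0 h1 (fun i => a i * x i) hp hxE ?_).trans
        (measure_mono fun s hs => ?_)
      · refine le_trans ?_ hvar
        have : ∑ i, (a i * x i) ^ 2 ≤ ∑ i, a i ^ 2 * C ^ 2 := Finset.sum_le_sum fun i _ => by
          rw [mul_pow, ← sq_abs (x i)]
          have := (hx i).2
          gcongr
        rw [← Finset.sum_mul, ha] at this
        linarith
      · simp only [B, Set.mem_preimage, Set.mem_ofPred_eq] at hs ⊢
        simpa only [mul_assoc, mul_comm (s _)] using hs
    · simp [hxE]
  have hupper : ((Measure.pi ν).prod ρ) B = Measure.pi ν F := by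
    rw [Measure.prod_apply_symm hB]
    have : ∀ᵐ s ∂ρ, Measure.pi ν ((fun x => (x, s)) ⁻¹' B) = Measure.pi ν F := by
      filter_upwards [ae_all_iff.2 fun i => (Measure.quasiMeasurePreserving_eval
        (fun _ : ι => biasedSign β) i).ae (ae_biasedSign β)] with s hs
      exact measure_sign_mul_pi hsym hs a measurableSet_Icc
    rw [lintegral_congr_ae this]
    simp
  rw [hupper] at hlower
  have := ENNReal.toReal_mono (measure_ne_top _ _) hlower
  rw [ENNReal.toReal_mul] at this
  simp only [measureReal_def]
  norm_num at this
  linarith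

end Shrinking

/-! ### Choice of constants and the two regimes of `t`. -/

theorem lemma3p5 (C : ℝ) (hC : 1 ≤ C) :
    ∃ c₀ ∈ Set.Ioo (0 : ℝ) 1, ∃ c₁ ∈ Set.Ioo (0 : ℝ) 1,
      ∀ (η' : ℝ), η' ∈ Set.Ioo (0 : ℝ) (1 / (32 * C)) →
      ∀ (κ : ℝ), κ ∈ Set.Ioo (0 : ℝ) 1 →
      ∀ (ℓ : ℕ) (Ω : Type*) [MeasurableSpace Ω] (μ : Measure Ω) [IsProbabilityMeasure μ]
        (X : Fin ℓ → Ω → ℝ),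
      iIndepFun X μ →
      (∀ i, ∫ ω, X i ω ∂μ = 0) →
      -- each variable is symmetric: `X i` and `-X i` have the same law
      (∀ i, IdentDistrib (X i) (fun ω => -X i ω) μ μ) →
      (∀ i, ∀ᵐ ω ∂μ, X i ω ∈ Set.Icc (-C) (-1) ∪ Set.Icc 1 C) →
      ∀ (a : EuclideanSpace ℝ (Fin ℓ)) (η : ℝ),
      ‖a‖ = 1 → (∀ i, |a i| ≤ η) →
      ∀ (t β : ℝ), 1 ≤ t → β ∈ Set.Ioo (1 / (16 * C)) (7 / (16 * C)) → η < c₁ * t →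
      κ ≤ μ.real {ω | ∑ i, a i * X i ω ∈ Set.Icc ((1 - η') * t) ((1 + η') * C * t)} →
      min (κ / 2) c₀ ≤
        μ.real {ω | ∑ i, a i * X i ω ∈
          Set.Icc (β / 2 * (1 - η') * t) (3 / 2 * β * (1 + η') * C * t)} := by
  have hC0 : 0 < C := by linarith
  -- The steering error `5 * C ^ 2 / n` must be at most `β / 2`, for which `160 * C ^ 3` suffices,
  -- and the target `β * t < 60 * C ^ 2` must be at most `n / 3`.
  obtain ⟨n, hnC⟩ := exists_nat_ge (200 * C ^ 3)
  have hC2 : C ≤ C ^ 2 := by nlinarith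
  have hC23 : C ^ 2 ≤ C ^ 3 := by nlinarith
  have hn1 : (1 : ℝ) ≤ n := by nlinarith
  have hn0 : 0 < n := by exact_mod_cast (by linarith : (0 : ℝ) < n)
  have hn' : (0 : ℝ) < n := by linarith
  have hbase : 1 / (200 * C ^ 4) < 1 := by
    rw [div_lt_one (by positivity)]
    nlinarith [one_le_pow₀ hC (n := 4)]
  refine ⟨(1 / (200 * C ^ 4)) ^ n ^ 2, ⟨by positivity, pow_lt_one₀ (by positivity) hbase
    (by positivity)⟩, 1 / (120 * C ^ 2 * n), ⟨by positivity, ?_⟩, ?_⟩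
  · rw [div_lt_one (by positivity)]
    nlinarith [mul_le_mul hC2 hn1 zero_le_one (by positivity)]
  intro η' hη' κ hκ ℓ Ω _ μ _ X hind _ hsymX habsX a η ha haη t β ht hβ hη hκE
  have hX : ∀ i, AEMeasurable (X i) μ := fun i => (hsymX i).aemeasurable_fst
  set ν : Fin ℓ → Measure ℝ := fun i => μ.map (X i) with hν
  have : ∀ i, IsProbabilityMeasure (ν i) := fun i => Measure.isProbabilityMeasure_map (hX i)
  have hsym : ∀ i, (ν i).map (fun x => -x) = ν i := fun i => by
    rw [hν, AEMeasurable.map_map_of_aemeasurable (by fun_prop) (hX i)]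
    exact (hsymX i).map_eq.symm
  have habs : ∀ i, ∀ᵐ x ∂ν i, 1 ≤ |x| ∧ |x| ≤ C := fun i => by
    have hm : MeasurableSet {x : ℝ | 1 ≤ |x| ∧ |x| ≤ C} :=
      (by fun_prop : Measurable fun x : ℝ => |x|) measurableSet_Icc
    rw [hν, ae_map_iff (hX i) hm]
    filter_upwards [habsX i] with ω hω
    rcases hω with h | h
    · rw [abs_of_nonpos (by linarith [h.2])]
      exact ⟨by linarith [h.2], by linarith [h.1]⟩
    · rw [abs_of_nonneg (by linarith [h.1])]
      exact h
  have hsum : ∑ i, a i ^ 2 = 1 := by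
    have h := EuclideanSpace.real_norm_sq_eq a
    rw [ha] at h
    linarith
  have hlaw : ∀ A : Set ℝ, MeasurableSet A → μ.real {ω | ∑ i, a i * X i ω ∈ A}
      = (Measure.pi ν).real {x | ∑ i, a i * x i ∈ A} := fun A hA => by
    have hm : MeasurableSet {x : Fin ℓ → ℝ | ∑ i, a i * x i ∈ A} :=
      (by fun_prop : Measurable fun x : Fin ℓ → ℝ => ∑ i, a i * x i) hA
    rw [hν, ← (iIndepFun_iff_map_fun_eq_pi_map hX).1 hind, map_measureReal_apply_of_aemeasurable
      (aemeasurable_pi_lambda _ hX) hm]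
    rfl
  rw [hlaw _ measurableSet_Icc] at hκE ⊢
  have hη'2 : η' < 1 / 32 := hη'.2.trans_le (by
    rw [div_le_div_iff₀ (by positivity) (by positivity)]; linarith)
  have hβ1 : 1 < 16 * C * β := by
    have := hβ.1
    rw [div_lt_iff₀ (by positivity)] at this
    linarith
  have hβ2 : 16 * C * β < 7 := by
    have := hβ.2
    rw [lt_div_iff₀ (by positivity)] at this
    linarith
  have hβ0 : 0 < β := lt_trans (by positivity) hβ.1
  have hβle : β ≤ 1 := by nlinarith
  have hη'0 := hη'.1
  -- Above the threshold `β * (1 - η') * t ≥ 3 * C`, whose square exceeds the `8 * C ^ 2` needed.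
  -- Below it, `c₁ * t ≤ 1 / (2 * n)` bounds every coefficient.
  rcases le_or_gt (60 * C ^ 2) t with hT | hT
  · refine (min_le_left _ _).trans ((div_le_div_of_nonneg_right hκE zero_le_two).trans ?_)
    have hp : 31 / 32 * t ≤ (1 - η') * t := by
      have : 31 / 32 ≤ 1 - η' := by linarith
      gcongr
    have h := measureReal_div_two_le_measureReal_shrink hsym habs hsum hβ0 hβle
      (p := (1 - η') * t) (q := (1 + η') * C * t) (by linarith) (by
        have h1 : 3 * C ≤ β * ((1 - η') * t) := by
          calc 3 * C ≤ 31 / 32 * (60 / 16) * C := by linarith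
            _ ≤ 31 / 32 * (60 / 16) * C * (16 * C * β) := le_mul_of_one_le_right (by positivity)
                hβ1.le
            _ = β * (31 / 32 * (60 * C ^ 2)) := by ring
            _ ≤ β * ((1 - η') * t) := by gcongr 1; linarith
        have h2 := pow_le_pow_left₀ (by positivity) h1 2
        rw [← mul_pow]
        nlinarith)
    rwa [← mul_assoc, show 3 / 2 * β * ((1 + η') * C * t) = 3 / 2 * β * (1 + η') * C * t by ring]
      at h
  · refine (min_le_right _ _).trans ?_
    have hsmall : ∀ i, a i ^ 2 ≤ 1 / (2 * (n : ℝ) ^ 2) := fun i => by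
      have h1 : |a i| ≤ 1 / (2 * n) := by
        refine (haη i).trans (hη.le.trans ?_)
        calc 1 / (120 * C ^ 2 * n) * t ≤ 1 / (120 * C ^ 2 * n) * (60 * C ^ 2) := by gcongr
          _ = 1 / (2 * (n : ℝ)) := by field_simp; norm_num
      have h2 := pow_le_pow_left₀ (abs_nonneg _) h1 2
      rw [sq_abs] at h2
      refine h2.trans ?_
      rw [div_pow, one_pow, mul_pow]
      gcongr
      norm_num
    have hm0 : 0 < β * t := by positivity
    have hm : |β * t| ≤ n / 3 := by
      rw [abs_of_pos hm0]
      have : β * t ≤ 1 * (60 * C ^ 2) := by gcongr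
      linarith
    refine (le_measureReal_abs_sub_sum_le hC hsym habs hsum hn0 hsmall hm).trans
      (measureReal_mono fun x hx => ?_)
    have hwidth : 5 * C ^ 2 / n ≤ β * t / 2 := by
      rw [div_le_iff₀ hn']
      have h1 : β ≤ β * t := le_mul_of_one_le_right hβ0.le ht
      calc 5 * C ^ 2 ≤ 5 * C ^ 2 * (16 * C * β) :=
            le_mul_of_one_le_right (by positivity) hβ1.le
        _ = β / 2 * (160 * C ^ 3) := by ring
        _ ≤ β * t / 2 * n := by
          have : 0 < C ^ 3 := by positivity
          gcongr
          linarith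
    have hx' := abs_le.1 (le_trans (Set.mem_ofPred_eq ▸ hx) hwidth)
    have h2 : β * t ≤ β * t * ((1 + η') * C) := le_mul_of_one_le_right hm0.le (by nlinarith)
    have h3 : 0 ≤ β * t * η' := by positivity
    constructor <;> nlinarith
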